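/- A signed graph $(G,\Sigma)$ consists of a finite graph $G$, in which parallel edges are permitted but loops are not, and a set $\Sigma\subseteq E(G)$; the edges in $\Sigma$ are called odd and the other edges even. Let $S(G,\Sigma)$ be the set of real symmetric matrices $A=[a_{i,j}]_{i,j\in V(G)}$ such that $a_{i,j}<0$ if $i$ and $j$ are connected by only even edges, $a_{i,j}>0$ if $i$ and $j$ are connected by only odd edges, and $a_{i,j}=0$ if $i\neq j$ and $i$ and $j$ are non-adjacent (the entries $a_{i,i}$, and the entries $a_{i,j}$ with $i$ and $j$ connected by both even and odd edges, are arbitrary). A matrix $A\in S(G,\Sigma)$ has the Strong Arnold Property if $X=0$ is the only symmetric matrix $X=[x_{i,j}]$ such that $AX=0$ and $x_{i,j}=0$ whenever $i=j$ or $i$ and $j$ are adjacent. Let $\nu(G,\Sigma)$ be the largest nullity of a positive semidefinite matrix $A\in S(G,\Sigma)$ that has the Strong Arnold Property. Consider the following operations on a signed graph $(G,\Sigma)$. - Contracting an even edge means deleting it and identifying its ends, retaining the signs of the other edges. Contracting an odd edge means first replacing $\Sigma$ by $\Sigma\,\Delta\,\delta(x)$, where $x$ is one of the ends of the edge and $\delta(x)$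 is the set of edges incident to $x$, and then contracting the edge, which is now even. - Series reduction on $v$: if the vertex $v$ is incident to exactly two edges $e,f$, and these lead to two distinct neighbors $u,w$ of $v$, delete $v$ and add a new edge between $u$ and $w$ (in parallel to any edges already connecting them), which is odd if exactly one of $e,f$ is odd, and even otherwise. - Series-parallel reduction on $v$: if the vertex $v$ is incident to exactly three edges $e,f,g$, where $e$ and $f$ are parallel edges between $v$ and a vertex $u$, and $g$ connects $v$ to a vertex $w\neq u$, contract $g$. (No condition is imposed on the signs of $e$ and $f$; in particular one of them may be odd and the other even.) Lemma. If the signed graph $(G_1,\Sigma_1)$ is obtained from a signed graph $(G,\Sigma)$ by a series reduction or by a series-parallel reduction, then $\nu(G_1,\Sigma_1)=\nu(G,\Sigma)$. -/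

import Mathlib

open scoped Graph

/-- A signed graph `(G, Σ)`: a multigraph `G` with finitely many vertices, in which parallel edges
are permitted but loops are not, with a set `Σ` (here `odd`) of edges. The edges in `odd` are the
odd edges of the signed graph, its other edges are the even ones. -/
structure SignedGraph (α β : Type*) where
  graph : Graph α β
  vertexSet_finite : V(graph).Finite
  loopless : graph.Loopless
  odd : Set β
  odd_subset : odd ⊆ E(graph)

namespace SignedGraph

variable {α β : Type*}

noncomputable instance instFintypeVertexSet (G : SignedGraph α β) : Fintype V(G.graph) :=
  G.vertexSet_finite.fintype

/-- Some edge connects `x` and `y`, and every edge that does is even. -/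
def OnlyEven (G : SignedGraph α β) (x y : α) : Prop :=
  G.graph.Adj x y ∧ ∀ e, G.graph.IsLink e x y → e ∉ G.odd

/-- Some edge connects `x` and `y`, and every edge that does is odd. -/
def OnlyOdd (G : SignedGraph α β) (x y : α) : Prop :=
  G.graph.Adj x y ∧ ∀ e, G.graph.IsLink e x y → e ∈ G.odd

/-- The set `S(G, Σ)` of real symmetric matrices, indexed by the vertices. The diagonal entries, and
the entries at pairs of vertices connected by both even and odd edges, are unrestricted. -/
def matrices (G : SignedGraph α β) : Set (Matrix V(G.graph) V(G.graph) ℝ) :=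
  {A | A.IsSymm ∧
    (∀ i j : V(G.graph), G.OnlyEven i j → A i j < 0) ∧
    (∀ i j : V(G.graph), G.OnlyOdd i j → 0 < A i j) ∧
    (∀ i j : V(G.graph), i ≠ j → ¬ G.graph.Adj i j → A i j = 0)}

/-- The Strong Arnold Property: `X = 0` is the only symmetric matrix with `A X = 0` whose entries
vanish on the diagonal and at the pairs of adjacent vertices. -/
def HasSAP (G : SignedGraph α β) (A : Matrix V(G.graph) V(G.graph) ℝ) : Prop :=
  ∀ X : Matrix V(G.graph) V(G.graph) ℝ, X.IsSymm →
    (∀ i j : V(G.graph), i = j ∨ G.graph.Adj i j → X i j = 0) → A * X = 0 → X = 0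

/-- The nullity of a real square matrix: the dimension of its kernel. -/
noncomputable def nullity {n : Type*} [Fintype n] (A : Matrix n n ℝ) : ℕ :=
  Module.finrank ℝ (LinearMap.ker A.mulVecLin)

/-- The parameter `ν(G, Σ)`: the largest nullity of a positive semidefinite matrix in `S(G, Σ)` that
has the Strong Arnold Property. The set of these nullities is bounded by the number of vertices, and
it contains `0`, because `S(G, Σ)` contains positive definite matrices; so the supremum is a
maximum. -/
noncomputable def nu (G : SignedGraph α β) : ℕ :=
  sSup {k | ∃ A ∈ G.matrices, A.PosSemidef ∧ G.HasSAP A ∧ nullity A = k}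

/-- The set `δ(U)` of the edges with one end in `U` and one end outside `U`. -/
def cut (G : SignedGraph α β) (U : Set α) : Set β :=
  {e | ∃ x y, G.graph.IsLink e x y ∧ x ∈ U ∧ y ∉ U}

/-- Re-signing on `U`: replace `Σ` by the symmetric difference of `Σ` and `δ(U)`. -/
def resign (G : SignedGraph α β) (U : Set α) : SignedGraph α β where
  graph := G.graph
  vertexSet_finite := G.vertexSet_finite
  loopless := G.loopless
  odd := symmDiff G.odd (G.cut U)
  odd_subset := by
    rintro e (⟨h, -⟩ | ⟨⟨x, y, h, -⟩, -⟩)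
    · exact G.odd_subset h
    · exact h.edge_mem

open Classical in
/-- `H` is obtained from `G` by contracting the even edge `g`: delete `g`, identify its two ends `x`
and `y` to one vertex `z`, and retain all other vertices, edges and signs. The name of `z` is
arbitrary, as long as it differs from the names of the other vertices. Since `H` has no loops, this
entails that no other edge of `G` connects `x` and `y`. -/
def IsEvenContraction (G : SignedGraph α β) (g : β) (H : SignedGraph α β) : Prop :=
  ∃ x y z, G.graph.IsLink g x y ∧ g ∉ G.odd ∧ z ∉ V(G.graph) \ {x, y} ∧
    H.graph = (G.graph.deleteEdges {g}).map (fun t => if t = x ∨ t = y then z else t) ∧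
    H.odd = G.odd

/-- `H` is obtained from `G` by contracting the edge `g`. If `g` is odd, then first re-sign around
one of the two ends of `g` (either one), which makes `g` even. -/
def IsContraction (G : SignedGraph α β) (g : β) (H : SignedGraph α β) : Prop :=
  (g ∉ G.odd ∧ G.IsEvenContraction g H) ∨
    (g ∈ G.odd ∧ ∃ x, G.graph.Inc g x ∧ (G.resign {x}).IsEvenContraction g H)

/-- `H` is obtained from `G` by a series reduction on `v`: the vertex `v` is incident to exactly two
edges `e` and `f`, which lead to two distinct neighbors `u` and `w`; delete `v`, and connect `u` and
`w` by a new edge `b`, which is odd if and only if exactly one of `e` and `f` is odd. -/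
def IsSeriesReduction (G : SignedGraph α β) (v : α) (H : SignedGraph α β) : Prop :=
  ∃ e f b u w,
    G.graph.IsLink e v u ∧ G.graph.IsLink f v w ∧ u ≠ w ∧ G.graph.incidenceSet v = {e, f} ∧
    b ∉ E(G.graph.deleteVerts {v}) ∧
    V(H.graph) = V(G.graph) \ {v} ∧
    (∀ d x y, H.graph.IsLink d x y ↔
      (G.graph.deleteVerts {v}).IsLink d x y ∨ (d = b ∧ s(x, y) = s(u, w))) ∧
    (∀ d ∈ E(G.graph.deleteVerts {v}), d ∈ H.odd ↔ d ∈ G.odd) ∧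
    (b ∈ H.odd ↔ Xor (e ∈ G.odd) (f ∈ G.odd))

/-- `H` is obtained from `G` by a series-parallel reduction on `v`: the vertex `v` has exactly two
neighbors `u` and `w` and is incident to exactly three edges, of which two, `e` and `f`, are parallel
and lead to `u`, and the third one, `g`, leads to `w`; contract `g`. (The case of interest is the
one where one of `e` and `f` is odd and the other is even; no condition on their signs is needed.) -/
def IsSeriesParallelReduction (G : SignedGraph α β) (v : α) (H : SignedGraph α β) : Prop :=
  ∃ e f g u w,
    e ≠ f ∧ G.graph.IsLink e v u ∧ G.graph.IsLink f v u ∧ G.graph.IsLink g v w ∧ u ≠ w ∧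
    G.graph.incidenceSet v = {e, f, g} ∧ G.IsContraction g H

end SignedGraph

/-! Both reductions suppress a vertex `v` with exactly two neighbors `u` and `w`, where the edges
between `v` and `w` all have one sign. The remaining graph is kept, and each path `u`-`v`-`w`
becomes an edge `u`-`w` with the product sign. For the series-parallel reduction this uses that the
contracted edge is even, which re-signing achieves without changing ν.

On matrices the suppression is the Schur complement at `v`. If `A` is positive semidefinite, the
nonzero entry `A v w` forces `A v v > 0`, so the complement exists. It changes off-diagonal entries
only at `u`, `w`, by `-(A v u * A v w) / A v v`, which has the sign required of the new edges
(`schurNone_mem`). Conversely, every matrix of the reduced graph is the Schur complement of a matrix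
of the original graph with entry 1 at `v` (`exists_schurNone_eq`).

Schur complements preserve positive semidefiniteness and nullity (`posSemidef_schurNone_iff`,
`nullity_schurNone`). They also preserve the Strong Arnold Property here (`hasSAP_schurNone_iff`),
because the new adjacency `u`-`w` costs nothing: the equation of row `v` already forces `X w u = 0`.
Hence the two sets of attainable nullities coincide, and so do their suprema. -/

section

/-! ### Sign conditions on single entries -/

open Matrix

/-- The condition that a pair of vertices imposes on the matrix entry `a`, where `e` and `o` say
whether the pair is connected by an even and by an odd edge. -/
def SignAdmissible (e o : Prop) (a : ℝ) : Prop :=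
  (e ∧ ¬ o → a < 0) ∧ (o ∧ ¬ e → 0 < a) ∧ (¬ e → ¬ o → a = 0)

theorem SignAdmissible.neg {e o : Prop} {a : ℝ} (h : SignAdmissible e o a) :
    SignAdmissible o e (-a) :=
  ⟨fun ho => by linarith [h.2.1 ho], fun he => by linarith [h.1 he],
    fun ho he => by rw [h.2.2 he ho, neg_zero]⟩

theorem signAdmissible_of_both {e o : Prop} (he : e) (ho : o) (a : ℝ) : SignAdmissible e o a :=
  ⟨fun h => absurd ho h.2, fun h => absurd he h.2, fun h => absurd he h⟩

theorem SignAdmissible.ne_zero {e o : Prop} {a : ℝ} (h : SignAdmissible e o a) (hadj : e ∨ o)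
    (hone : ¬ (e ∧ o)) : a ≠ 0 := by
  rcases hadj with he | ho
  · exact (h.1 ⟨he, fun ho => hone ⟨he, ho⟩⟩).ne
  · exact (h.2.1 ⟨ho, fun he => hone ⟨he, ho⟩⟩).ne'

/-- Adding an edge in parallel, in terms of matrix entries. -/
theorem SignAdmissible.parallel {e o e' o' : Prop} {a a' : ℝ} (h : SignAdmissible e o a)
    (h' : SignAdmissible e' o' a') (hadj : e' ∨ o') : SignAdmissible (e ∨ e') (o ∨ o') (a + a') := by
  obtain ⟨h1, h2, h3⟩ := h
  obtain ⟨h1', h2', h3'⟩ := h'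
  refine ⟨fun ⟨_, hn⟩ => ?_, fun ⟨_, hn⟩ => ?_, fun x y => ?_⟩
  · obtain ⟨ho, ho'⟩ := not_or.1 hn
    have := h1' ⟨hadj.resolve_right ho', ho'⟩
    by_cases he : e
    · linarith [h1 ⟨he, ho⟩]
    · linarith [h3 he ho]
  · obtain ⟨he, he'⟩ := not_or.1 hn
    have := h2' ⟨hadj.resolve_left he', he'⟩
    by_cases ho : o
    · linarith [h2 ⟨ho, he⟩]
    · linarith [h3 he ho]
  · exact absurd hadj (not_or.2 ⟨(not_or.1 x).2, (not_or.1 y).2⟩)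

/-- Every admissible entry splits as a sum when a parallel edge is deleted. -/
theorem SignAdmissible.exists_parallel {e o e' o' : Prop} {b : ℝ}
    (h : SignAdmissible (e ∨ e') (o ∨ o') b) (hadj : e' ∨ o') :
    ∃ r, SignAdmissible e' o' (-r) ∧ SignAdmissible e o (b + r) := by
  obtain ⟨h1, h2, -⟩ := h
  have hb := neg_abs_le b
  have hb' := le_abs_self b
  -- If the old edges have both signs, only the new share is constrained. If they have one sign and
  -- a new edge has the other, a shift by `|b| + 1` dominates `b`. If all edges agree in sign, `b`
  -- is halved. Without old edges, the new ones take all of `b`.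
  by_cases he : e <;> by_cases ho : o
  · by_cases hE : e' <;> by_cases hO : o'
    · exact ⟨0, signAdmissible_of_both hE hO _, signAdmissible_of_both he ho _⟩
    · exact ⟨1, by simp [SignAdmissible, hE, hO], signAdmissible_of_both he ho _⟩
    · exact ⟨-1, by simp [SignAdmissible, hE, hO], signAdmissible_of_both he ho _⟩
    · tauto
  · by_cases hO : o'
    · refine ⟨-|b| - 1, ⟨fun hh => absurd hO hh.2, fun _ => ?_, fun _ hh => absurd hO hh⟩,
        ⟨fun _ => ?_, fun hh => absurd hh.1 ho, fun hh => absurd he hh⟩⟩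
      · linarith [abs_nonneg b]
      · linarith
    · have := h1 ⟨Or.inl he, by tauto⟩
      refine ⟨-b / 2, ⟨fun _ => ?_, fun hh => absurd hh.1 hO, fun _ => ?_⟩,
        ⟨fun _ => ?_, fun hh => absurd hh.1 ho, fun hh => absurd he hh⟩⟩
      · linarith
      · tauto
      · linarith
  · by_cases hE : e'
    · refine ⟨|b| + 1, ⟨fun _ => ?_, fun hh => absurd hE hh.2, fun hh => absurd hE hh⟩,
        ⟨fun hh => absurd hh.1 he, fun _ => ?_, fun _ hh => absurd ho hh⟩⟩
      · linarith [abs_nonneg b]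
      · linarith
    · have := h2 ⟨Or.inl ho, by tauto⟩
      refine ⟨-b / 2, ⟨fun hh => absurd hh.1 hE, fun _ => ?_, fun _ => ?_⟩,
        ⟨fun hh => absurd hh.1 he, fun _ => ?_, fun _ hh => absurd ho hh⟩⟩
      · linarith
      · tauto
      · linarith
  · refine ⟨-b, ⟨fun hh => ?_, fun hh => ?_, by tauto⟩, by simp [SignAdmissible, he, ho]⟩
    · linarith [h1 (by tauto)]
    · linarith [h2 (by tauto)]

/-- The entry of a path of two edges, the second of which is unambiguous. -/
theorem SignAdmissible.series {e o e' o' : Prop} {p q : ℝ} (hp : SignAdmissible e o p)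
    (hq : SignAdmissible e' o' q) (hadj : e ∨ o) (hadj' : e' ∨ o') (hone : ¬ (e' ∧ o')) :
    SignAdmissible ((e ∧ e') ∨ (o ∧ o')) ((e ∧ o') ∨ (o ∧ e')) (-(p * q)) := by
  obtain ⟨h1, h2, -⟩ := hp
  obtain ⟨k1, k2, -⟩ := hq
  rcases hadj' with he | ho
  · have ho : ¬ o' := fun ho => hone ⟨he, ho⟩
    have hq := k1 ⟨he, ho⟩
    simp only [he, ho, and_true, and_false, or_false, false_or]
    exact ⟨fun hh => by nlinarith [h1 hh], fun hh => by nlinarith [h2 hh],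
      fun x y => absurd hadj (not_or.2 ⟨x, y⟩)⟩
  · have he : ¬ e' := fun he => hone ⟨he, ho⟩
    have hq := k2 ⟨ho, he⟩
    simp only [he, ho, and_true, and_false, or_false, false_or]
    exact ⟨fun hh => by nlinarith [h2 hh], fun hh => by nlinarith [h1 hh],
      fun x y => absurd hadj (not_or.2 ⟨y, x⟩)⟩

/-- The unambiguous second entry can be normalized to `-1` or `1`; the first then carries the value
`r` up to sign. -/
theorem SignAdmissible.exists_series {e o e' o' : Prop} {r : ℝ}
    (hr : SignAdmissible ((e ∧ e') ∨ (o ∧ o')) ((e ∧ o') ∨ (o ∧ e')) (-r))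
    (hadj' : e' ∨ o') (hone : ¬ (e' ∧ o')) :
    ∃ p q, SignAdmissible e o p ∧ SignAdmissible e' o' q ∧ p * q = r := by
  rcases hadj' with he | ho
  · have ho : ¬ o' := fun ho => hone ⟨he, ho⟩
    simp only [he, ho, and_true, and_false, or_false, false_or] at hr
    exact ⟨-r, -1, hr, by simp [SignAdmissible, he, ho], by ring⟩
  · have he : ¬ e' := fun he => hone ⟨he, ho⟩
    simp only [he, ho, and_true, and_false, or_false, false_or] at hr
    exact ⟨r, 1, by simpa using hr.neg, by simp [SignAdmissible, he, ho], by ring⟩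

/-! ### Sign patterns, relabelling and switching -/

/-- For each pair of vertices, whether it is connected by an even and by an odd edge. This is all
that the matrices of a signed graph depend on. -/
structure SignPattern (n : Type*) where
  even : n → n → Prop
  odd : n → n → Prop
  even_symm : ∀ i j, even i j → even j i
  odd_symm : ∀ i j, odd i j → odd j i
  even_irrefl : ∀ i, ¬ even i i
  odd_irrefl : ∀ i, ¬ odd i i

namespace SignPattern

variable {n m : Type*}

def Adj (P : SignPattern n) (i j : n) : Prop := P.even i j ∨ P.odd i j

theorem Adj.symm {P : SignPattern n} {i j : n} (h : P.Adj i j) : P.Adj j i :=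
  h.imp (P.even_symm i j) (P.odd_symm i j)

theorem Adj.ne {P : SignPattern n} {i j : n} (h : P.Adj i j) : i ≠ j := by
  rintro rfl
  exact h.elim (P.even_irrefl i) (P.odd_irrefl i)

def matrices (P : SignPattern n) : Set (Matrix n n ℝ) :=
  {A | A.IsSymm ∧ ∀ i j, i ≠ j → SignAdmissible (P.even i j) (P.odd i j) (A i j)}

def HasSAP [Fintype n] (P : SignPattern n) (A : Matrix n n ℝ) : Prop :=
  ∀ X : Matrix n n ℝ, X.IsSymm → (∀ i j, i = j ∨ P.Adj i j → X i j = 0) → A * X = 0 → X = 0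

/-- The nullities of the positive semidefinite matrices with the Strong Arnold Property. -/
def nullities [Fintype n] (P : SignPattern n) : Set ℕ :=
  {k | ∃ A ∈ P.matrices, A.PosSemidef ∧ P.HasSAP A ∧ SignedGraph.nullity A = k}

theorem nullity_add_rank [Fintype n] (A : Matrix n n ℝ) :
    SignedGraph.nullity A + A.rank = Fintype.card n := by
  rw [SignedGraph.nullity, add_comm, Matrix.rank, LinearMap.finrank_range_add_finrank_ker,
    Module.finrank_fintype_fun_eq_card]

/-- The pattern induced along an injection. -/
def comap (P : SignPattern n) (σ : m → n) : SignPattern m where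
  even i j := P.even (σ i) (σ j)
  odd i j := P.odd (σ i) (σ j)
  even_symm _ _ := P.even_symm _ _
  odd_symm _ _ := P.odd_symm _ _
  even_irrefl _ := P.even_irrefl _
  odd_irrefl _ := P.odd_irrefl _

theorem nullities_subset_comap [Fintype n] [Fintype m] (P : SignPattern n) (σ : m ≃ n) :
    P.nullities ⊆ (P.comap σ).nullities := by
  rintro k ⟨A, ⟨hs, hA⟩, hpos, hsap, rfl⟩
  refine ⟨A.submatrix σ σ, ⟨hs.submatrix σ, fun i j hij => hA _ _ (σ.injective.ne hij)⟩,
    hpos.submatrix σ, fun X hX hz hAX => ?_, ?_⟩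
  · have := hsap (X.submatrix σ.symm σ.symm) (hX.submatrix _) (fun i j hij => hz _ _ ?_) ?_
    · ext i j
      simpa using congrFun (congrFun this (σ i)) (σ j)
    · simpa [Adj, comap] using hij
    · have h2 : A = (A.submatrix σ σ).submatrix σ.symm σ.symm := by simp
      rw [h2, Matrix.submatrix_mul_equiv, hAX]
      rfl
  · have h1 := nullity_add_rank A
    have h2 := nullity_add_rank (A.submatrix σ σ)
    rw [Matrix.rank_submatrix, Fintype.card_congr σ] at h2
    omega

theorem nullities_comap [Fintype n] [Fintype m] (P : SignPattern n) (σ : m ≃ n) :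
    (P.comap σ).nullities = P.nullities := by
  refine Set.Subset.antisymm ?_ (P.nullities_subset_comap σ)
  have h := (P.comap σ).nullities_subset_comap σ.symm
  have h2 : (P.comap σ).comap σ.symm = P := by
    simp [comap]
  rwa [h2] at h

/-- `Q` arises from `P` by switching the signs along `s`. -/
def IsSwitching (P Q : SignPattern n) (s : n → Prop) : Prop :=
  (∀ i j, (s i ↔ s j) → (Q.even i j ↔ P.even i j) ∧ (Q.odd i j ↔ P.odd i j)) ∧
    ∀ i j, ¬ (s i ↔ s j) → (Q.even i j ↔ P.odd i j) ∧ (Q.odd i j ↔ P.even i j)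

theorem IsSwitching.symm {P Q : SignPattern n} {s : n → Prop} (h : IsSwitching P Q s) :
    IsSwitching Q P s :=
  ⟨fun i j hij => ⟨(h.1 i j hij).1.symm, (h.1 i j hij).2.symm⟩,
    fun i j hij => ⟨(h.2 i j hij).2.symm, (h.2 i j hij).1.symm⟩⟩

theorem IsSwitching.adj_iff {P Q : SignPattern n} {s : n → Prop} (h : IsSwitching P Q s) (i j : n) :
    Q.Adj i j ↔ P.Adj i j := by
  by_cases hij : s i ↔ s j
  · rw [Adj, Adj, (h.1 i j hij).1, (h.1 i j hij).2]
  · rw [Adj, Adj, (h.2 i j hij).1, (h.2 i j hij).2, or_comm]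

-- Conjugation by the diagonal matrix `D` with entries `-1` on `s` and `1` elsewhere performs the
-- switching. Since `D * D = 1`, it preserves rank, and `X ↦ D * X * D` transports the test matrices
-- of the Strong Arnold Property.
open Classical in
theorem IsSwitching.nullities_subset [Fintype n] {P Q : SignPattern n} {s : n → Prop}
    (h : IsSwitching P Q s) : P.nullities ⊆ Q.nullities := by
  rintro k ⟨A, ⟨hs, hA⟩, hpos, hsap, rfl⟩
  set d : n → ℝ := fun i => if s i then -1 else 1 with hd
  have hdd : ∀ i, d i * d i = 1 := fun i => by by_cases hi : s i <;> simp [hd, hi]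
  set D : Matrix n n ℝ := Matrix.diagonal d with hD
  have hDD : D * D = 1 := by
    rw [hD, Matrix.diagonal_mul_diagonal, ← Matrix.diagonal_one]
    exact congrArg _ (funext hdd)
  have hDt : Dᴴ = D := by simp [hD]
  have hDt' : Dᵀ = D := Matrix.diagonal_transpose d
  have hentry : ∀ (M : Matrix n n ℝ) i j, (D * M * D) i j = d i * M i j * d j := fun M i j => by
    rw [hD, Matrix.mul_diagonal, Matrix.diagonal_mul]
  have hsymm : ∀ M : Matrix n n ℝ, M.IsSymm → (D * M * D).IsSymm := fun M hM => by
    rw [Matrix.IsSymm, Matrix.transpose_mul, Matrix.transpose_mul, hDt', hM.eq, Matrix.mul_assoc]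
  have hcancel : ∀ M : Matrix n n ℝ, D * (D * M) = M := fun M => by
    rw [← Matrix.mul_assoc, hDD, Matrix.one_mul]
  refine ⟨D * A * D, ⟨hsymm A hs, fun i j hij => ?_⟩, ?_, fun X hX hz hAX => ?_, ?_⟩
  · rw [hentry]
    by_cases hsij : s i ↔ s j
    · rw [(h.1 i j hsij).1, (h.1 i j hsij).2]
      have : d i * A i j * d j = A i j := by
        have : d i = d j := by simp only [hd, hsij]
        rw [this, mul_right_comm, hdd, one_mul]
      rw [this]
      exact hA i j hij
    · rw [(h.2 i j hsij).1, (h.2 i j hsij).2]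
      have : d i * A i j * d j = - A i j := by
        by_cases hi : s i <;> by_cases hj : s j <;> simp_all
      rw [this]
      exact (hA i j hij).neg
  · have := hpos.conjTranspose_mul_mul_same D
    rwa [hDt] at this
  · have h0 : D * X * D = 0 := by
      refine hsap _ (hsymm X hX) (fun i j hij => ?_) ?_
      · rw [hentry, hz i j (hij.imp_right (h.adj_iff i j).2), mul_zero, zero_mul]
      · have : A * (D * X * D) = D * ((D * A * D) * X) * D := by
          simp only [Matrix.mul_assoc, hcancel]
        rw [this, hAX, Matrix.mul_zero, Matrix.zero_mul]
    have : X = D * (D * X * D) * D := by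
      rw [Matrix.mul_assoc, Matrix.mul_assoc, Matrix.mul_assoc, hDD, Matrix.mul_one, hcancel]
    rw [this, h0, Matrix.mul_zero, Matrix.zero_mul]
  · have hu : IsUnit D.det := by
      rw [← Matrix.isUnit_iff_isUnit_det]
      exact IsUnit.of_mul_eq_one D hDD
    have h1 := nullity_add_rank A
    have h2 := nullity_add_rank (D * A * D)
    rw [Matrix.rank_mul_eq_left_of_isUnit_det _ _ hu,
      Matrix.rank_mul_eq_right_of_isUnit_det _ _ hu] at h2
    omega

theorem IsSwitching.nullities_eq [Fintype n] {P Q : SignPattern n} {s : n → Prop}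
    (h : IsSwitching P Q s) : P.nullities = Q.nullities :=
  h.nullities_subset.antisymm h.symm.nullities_subset

end SignPattern

/-! ### Schur complement at one vertex -/

section SchurComplement

variable {m : Type*}

/-- The Schur complement of the entry at `none`. -/
noncomputable def schurNone (A : Matrix (Option m) (Option m) ℝ) : Matrix m m ℝ :=
  fun i j => A (some i) (some j) - A (some i) none * A none (some j) / A none none

theorem schurNone_isSymm {A : Matrix (Option m) (Option m) ℝ} (hA : A.IsSymm) :
    (schurNone A).IsSymm := by
  ext i j
  simp only [schurNone, Matrix.transpose_apply]
  rw [hA.apply (some i) (some j), hA.apply none (some j), hA.apply none (some i), mul_comm]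

variable [Fintype m]

theorem mulVec_none (A : Matrix (Option m) (Option m) ℝ) (x : Option m → ℝ) :
    (A *ᵥ x) none = A none none * x none + ∑ k, A none (some k) * x (some k) := by
  simp [Matrix.mulVec, dotProduct, Fintype.sum_option]

/-- One step of Gaussian elimination, with row `none` as pivot row. -/
theorem mulVec_some {A : Matrix (Option m) (Option m) ℝ} (hd : A none none ≠ 0)
    (x : Option m → ℝ) (i : m) :
    (A *ᵥ x) (some i) = (schurNone A *ᵥ fun k => x (some k)) i
      + A (some i) none / A none none * (A *ᵥ x) none := by
  rw [mulVec_none]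
  simp only [Matrix.mulVec, dotProduct, Fintype.sum_option, schurNone, sub_mul,
    Finset.sum_sub_distrib, mul_add, Finset.mul_sum]
  have : ∀ k, A (some i) none * A none (some k) / A none none * x (some k)
      = A (some i) none / A none none * (A none (some k) * x (some k)) := fun k => by ring
  simp only [this]
  field_simp
  ring

/-- Completing the square in the variable at `none`. -/
theorem dotProduct_mulVec_eq_schurNone {A : Matrix (Option m) (Option m) ℝ} (hA : A.IsSymm)
    (hd : A none none ≠ 0) (x : Option m → ℝ) :
    x ⬝ᵥ (A *ᵥ x) = (fun k => x (some k)) ⬝ᵥ (schurNone A *ᵥ fun k => x (some k))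
      + (A *ᵥ x) none ^ 2 / A none none := by
  have h1 : ∑ k, A (some k) none * x (some k) = (A *ᵥ x) none - A none none * x none := by
    rw [mulVec_none, add_sub_cancel_left]
    exact Finset.sum_congr rfl fun k _ => by rw [hA.apply none (some k)]
  have h2 : ∀ c : ℝ, ∑ i, x (some i) * (A (some i) none / A none none * c)
      = c / A none none * ∑ k, A (some k) none * x (some k) := fun c => by
    rw [Finset.mul_sum]
    exact Finset.sum_congr rfl fun k _ => by ring
  rw [dotProduct, Fintype.sum_option]
  simp only [mulVec_some hd, mul_add, Finset.sum_add_distrib]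
  rw [h2, h1, dotProduct]
  field_simp
  ring

/-- The extension of a vector that makes the entry of the product at `none` vanish. -/
noncomputable def extendNone (A : Matrix (Option m) (Option m) ℝ) (y : m → ℝ) : Option m → ℝ
  | none => -(∑ k, A none (some k) * y k) / A none none
  | some k => y k

theorem mulVec_extendNone_none {A : Matrix (Option m) (Option m) ℝ} (hd : A none none ≠ 0)
    (y : m → ℝ) : (A *ᵥ extendNone A y) none = 0 := by
  rw [mulVec_none]
  simp only [extendNone]
  field_simp
  ring

theorem mulVec_extendNone_some {A : Matrix (Option m) (Option m) ℝ} (hd : A none none ≠ 0)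
    (y : m → ℝ) (i : m) : (A *ᵥ extendNone A y) (some i) = (schurNone A *ᵥ y) i := by
  rw [mulVec_some hd, mulVec_extendNone_none hd, mul_zero, add_zero]
  rfl

theorem extendNone_eq {A : Matrix (Option m) (Option m) ℝ} (hd : A none none ≠ 0)
    {x : Option m → ℝ} (hx : (A *ᵥ x) none = 0) : extendNone A (fun k => x (some k)) = x := by
  rw [mulVec_none] at hx
  funext i
  cases i with
  | some k => rfl
  | none =>
    simp only [extendNone]
    field_simp
    linarith

/-- The two quadratic forms differ by a nonnegative square, which vanishes on the vectors
`extendNone A y`. -/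
theorem posSemidef_schurNone_iff {A : Matrix (Option m) (Option m) ℝ} (hA : A.IsSymm)
    (hd : 0 < A none none) : (schurNone A).PosSemidef ↔ A.PosSemidef := by
  constructor
  · intro h
    have hA' : A.IsHermitian := by
      rwa [Matrix.IsHermitian, conjTranspose_eq_transpose_of_trivial]
    refine .of_dotProduct_mulVec_nonneg hA' fun x => ?_
    rw [star_trivial, dotProduct_mulVec_eq_schurNone hA hd.ne']
    have := h.dotProduct_mulVec_nonneg (fun k => x (some k))
    rw [star_trivial] at this
    positivity
  · intro h
    refine .of_dotProduct_mulVec_nonneg ?_ fun y => ?_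
    · rw [Matrix.IsHermitian, conjTranspose_eq_transpose_of_trivial]
      exact schurNone_isSymm hA
    · have := h.dotProduct_mulVec_nonneg (extendNone A y)
      rw [star_trivial, dotProduct_mulVec_eq_schurNone hA hd.ne',
        mulVec_extendNone_none hd.ne'] at this
      simpa [extendNone] using this

/-- Forgetting the coordinate `none` maps one kernel isomorphically onto the other, with inverse
`extendNone A`. -/
theorem nullity_schurNone {A : Matrix (Option m) (Option m) ℝ} (hd : A none none ≠ 0) :
    SignedGraph.nullity (schurNone A) = SignedGraph.nullity A := by
  symm
  let restr : (Option m → ℝ) →ₗ[ℝ] (m → ℝ) := LinearMap.funLeft ℝ ℝ some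
  have hmem : ∀ x ∈ LinearMap.ker A.mulVecLin, restr x ∈ LinearMap.ker (schurNone A).mulVecLin := by
    intro x hx
    rw [LinearMap.mem_ker, Matrix.mulVecLin_apply] at hx ⊢
    funext i
    have := mulVec_some hd x i
    rw [hx] at this
    rw [Pi.zero_apply, Pi.zero_apply, mul_zero, add_zero] at this
    exact this.symm
  refine LinearEquiv.finrank_eq (LinearEquiv.ofBijective (restr.restrict hmem) ⟨?_, ?_⟩)
  · rintro ⟨x, hx⟩ ⟨y, hy⟩ hxy
    rw [LinearMap.mem_ker, Matrix.mulVecLin_apply] at hx hy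
    have hxy : (fun k => x (some k)) = fun k => y (some k) := congrArg Subtype.val hxy
    ext1
    change x = y
    rw [← extendNone_eq hd (congrFun hx none), ← extendNone_eq hd (congrFun hy none), hxy]
  · rintro ⟨y, hy⟩
    rw [LinearMap.mem_ker, Matrix.mulVecLin_apply] at hy
    refine ⟨⟨extendNone A y, ?_⟩, ?_⟩
    · rw [LinearMap.mem_ker, Matrix.mulVecLin_apply]
      funext i
      cases i with
      | none => exact mulVec_extendNone_none hd y
      | some i => rw [mulVec_extendNone_some hd, hy]; rfl
    · ext1
      rfl

/-- If the diagonal entry were zero, the unit vector at `none` would be isotropic, hence in the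
kernel, and its whole column would vanish. -/
theorem pos_none_of_posSemidef {A : Matrix (Option m) (Option m) ℝ} (hA : A.PosSemidef)
    {w : m} (hw : A (some w) none ≠ 0) : 0 < A none none := by
  classical
  refine lt_of_le_of_ne hA.diag_nonneg fun h0 => hw ?_
  have h1 : A *ᵥ Pi.single none 1 = 0 := by
    rw [← hA.dotProduct_mulVec_zero_iff]
    simp [← h0]
  simpa using congrFun h1 (some w)

end SchurComplement

/-! ### Suppressing a vertex with two neighbors -/

namespace SignPattern

variable {m : Type*}

/-- `Q` arises from `P` by suppressing the vertex `none`, whose only neighbors are `u` and `w`, and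
which is connected to `w` by edges of one sign only. -/
structure IsReduction (P : SignPattern (Option m)) (Q : SignPattern m) (u w : m) : Prop where
  ne : u ≠ w
  adj_none_iff : ∀ i, P.Adj none (some i) ↔ i = u ∨ i = w
  not_both : ¬ (P.even none (some w) ∧ P.odd none (some w))
  even_iff : ∀ i j, s(i, j) ≠ s(u, w) → (Q.even i j ↔ P.even (some i) (some j))
  odd_iff : ∀ i j, s(i, j) ≠ s(u, w) → (Q.odd i j ↔ P.odd (some i) (some j))
  even_uw : Q.even u w ↔ P.even (some u) (some w) ∨
    ((P.even none (some u) ∧ P.even none (some w)) ∨ (P.odd none (some u) ∧ P.odd none (some w)))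
  odd_uw : Q.odd u w ↔ P.odd (some u) (some w) ∨
    ((P.even none (some u) ∧ P.odd none (some w)) ∨ (P.odd none (some u) ∧ P.even none (some w)))

namespace IsReduction

variable {P : SignPattern (Option m)} {Q : SignPattern m} {u w : m}

theorem adj_u (h : IsReduction P Q u w) : P.Adj none (some u) := (h.adj_none_iff u).2 (.inl rfl)

theorem adj_w (h : IsReduction P Q u w) : P.Adj none (some w) := (h.adj_none_iff w).2 (.inr rfl)

theorem adj_uw (h : IsReduction P Q u w) : Q.Adj u w := by
  have h1 := h.adj_u
  have h2 := h.adj_w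
  rw [Adj] at h1 h2 ⊢
  rw [h.even_uw, h.odd_uw]
  tauto

theorem adj_of_adj (h : IsReduction P Q u w) {i j : m} (hij : P.Adj (some i) (some j)) :
    Q.Adj i j := by
  by_cases hs : s(i, j) = s(u, w)
  · rcases Sym2.eq_iff.1 hs with ⟨rfl, rfl⟩ | ⟨rfl, rfl⟩
    · exact h.adj_uw
    · exact h.adj_uw.symm
  · exact hij.imp (h.even_iff i j hs).2 (h.odd_iff i j hs).2

theorem sum_none [Fintype m] (h : IsReduction P Q u w) {A : Matrix (Option m) (Option m) ℝ}
    (hA : A ∈ P.matrices) (f : m → ℝ) :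
    ∑ k, A none (some k) * f k = A none (some u) * f u + A none (some w) * f w := by
  refine Fintype.sum_eq_add u w h.ne fun k hk => ?_
  have hk' : ¬ P.Adj none (some k) := fun h' => (not_or.2 hk) ((h.adj_none_iff k).1 h')
  rw [(hA.2 none (some k) (by simp)).2.2 (fun x => hk' (.inl x)) (fun x => hk' (.inr x)), zero_mul]

/-- Restriction away from `none` and columnwise extension by `extendNone` exchange the test matrices
`X` of the two sides. The pairs where zeros are prescribed differ, but the row equation at `none`
supplies what is missing in both directions. -/
theorem hasSAP_schurNone_iff [Fintype m] (h : IsReduction P Q u w) {A : Matrix (Option m) (Option m) ℝ}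
    (hA : A ∈ P.matrices) (hd : A none none ≠ 0) : Q.HasSAP (schurNone A) ↔ P.HasSAP A := by
  have hcol : ∀ {l : Type _} [Fintype l] (M X : Matrix l l ℝ) (i j : l),
      (M * X) i j = (M *ᵥ fun k => X k j) i := fun M X i j => rfl
  constructor
  · intro hsap X hX hz hAX
    have hAX' : ∀ i j, (A *ᵥ fun k => X k j) i = 0 := fun i j => by
      rw [← hcol, hAX]; rfl
    have hrow : ∀ j, X none j = -(A none (some u) * X (some u) j + A none (some w) * X (some w) j)
        / A none none := fun j => by
      have := hAX' none j
      rw [mulVec_none, h.sum_none hA fun k => X (some k) j] at this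
      field_simp
      linarith
    -- In the entry of `A * X` at `none`, `u`, the terms with `X none u` and `X u u` vanish by
    -- hypothesis, and the coefficient of `X w u` is nonzero because the edges to `w` have one sign.
    have hwu : X (some w) (some u) = 0 := by
      have h1 := hAX' none (some u)
      rw [mulVec_none, h.sum_none hA fun k => X (some k) (some u), hz none _ (.inr h.adj_u),
        hz (some u) _ (.inl rfl), mul_zero, mul_zero, zero_add, zero_add] at h1
      exact (mul_eq_zero.1 h1).resolve_left
        ((hA.2 none (some w) (by simp)).ne_zero h.adj_w h.not_both)
    have hY : X.submatrix some some = 0 := by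
      refine hsap _ (hX.submatrix _) (fun i j hij => ?_) ?_
      · rcases hij with rfl | hij
        · exact hz _ _ (.inl rfl)
        by_cases hs : s(i, j) = s(u, w)
        · rcases Sym2.eq_iff.1 hs with ⟨rfl, rfl⟩ | ⟨rfl, rfl⟩
          · rw [submatrix_apply, hX.apply, hwu]
          · exact hwu
        · exact hz _ _ (.inr (hij.imp (h.even_iff i j hs).1 (h.odd_iff i j hs).1))
      · ext i j
        have h1 := mulVec_some hd (fun k => X k (some j)) i
        rw [hAX', hAX', mul_zero, add_zero] at h1
        exact h1.symm
    have hs : ∀ i j, X (some i) (some j) = 0 := fun i j => congrFun (congrFun hY i) j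
    have hns : ∀ j, X none (some j) = 0 := fun j => by rw [hrow, hs, hs]; simp
    ext i j
    cases i with
    | none =>
      cases j with
      | none => exact hz _ _ (.inl rfl)
      | some j => exact hns j
    | some i =>
      cases j with
      | none => rw [hX.apply]; exact hns i
      | some j => exact hs i j
  · intro hsap X hX hz hBX
    have hBX' : ∀ i j, (schurNone A *ᵥ fun k => X k j) i = 0 := fun i j => by
      rw [← hcol, hBX]; rfl
    set y : m → ℝ := fun j => -(∑ k, A none (some k) * X k j) / A none none with hy
    -- Bordering `X` by `y` makes each column solve the equation at `none`; the corner entry comes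
    -- from extending `y` itself.
    set X' : Matrix (Option m) (Option m) ℝ := fun i j =>
      extendNone A (fun k => j.elim (y k) (X k)) i with hX'
    -- By symmetry of `X`, the vector `y` is a combination of its columns, so the Schur complement
    -- annihilates it as well.
    have hys : y = X *ᵥ fun k => - A none (some k) / A none none := by
      funext j
      simp only [hy, mulVec, dotProduct, ← Finset.sum_neg_distrib, Finset.sum_div]
      exact Finset.sum_congr rfl fun k _ => by rw [hX.apply j k]; ring
    have hyuw : ∀ j, X u j = 0 → X w j = 0 → y j = 0 := fun j hu hw => by
      simp only [hy]
      rw [h.sum_none hA, hu, hw]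
      simp
    have huw := hz u w (.inr h.adj_uw)
    have hwu := hz w u (.inr h.adj_uw.symm)
    have hyu : y u = 0 := hyuw u (hz _ _ (.inl rfl)) hwu
    have hyw : y w = 0 := hyuw w huw (hz _ _ (.inl rfl))
    have hadj : ∀ j, P.Adj none (some j) → y j = 0 := fun j hj => by
      rcases (h.adj_none_iff j).1 hj with rfl | rfl
      · exact hyu
      · exact hyw
    have h0 : X' = 0 := by
      refine hsap X' ?_ (fun i j hij => ?_) ?_
      · ext i j
        cases i <;> cases j
        · rfl
        · rfl
        · rfl
        · exact hX.apply _ _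
      · cases i with
        | none =>
          cases j with
          | none =>
            change -(∑ k, A none (some k) * y k) / A none none = 0
            rw [h.sum_none hA, hyu, hyw]
            simp
          | some j => exact hadj j (hij.resolve_left (by simp))
        | some i =>
          cases j with
          | none => exact hadj i (hij.resolve_left (by simp)).symm
          | some j => exact hz i j (hij.imp Option.some.inj h.adj_of_adj)
      · ext i j
        rw [hcol]
        cases i with
        | none => exact mulVec_extendNone_none hd _
        | some i =>
          refine (mulVec_extendNone_some hd _ i).trans ?_
          cases j with
          | some j => exact hBX' i j
          | none =>
            change (schurNone A *ᵥ y) i = 0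
            rw [hys, mulVec_mulVec, hBX, zero_mulVec]
            rfl
    ext i j
    exact congrFun (congrFun h0 (some i)) (some j)

/-- Column `none` is supported, off the diagonal, on `u` and `w`, so the correction affects only the
pair `u`, `w` and unrestricted diagonal entries. At `u`, `w` it is the entry of a parallel edge. -/
theorem schurNone_mem (h : IsReduction P Q u w) {A : Matrix (Option m) (Option m) ℝ}
    (hA : A ∈ P.matrices) (hd : 0 < A none none) : schurNone A ∈ Q.matrices := by
  have hB := schurNone_isSymm hA.1
  have huw : SignAdmissible (Q.even u w) (Q.odd u w) (schurNone A u w) := by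
    rw [h.even_uw, h.odd_uw, schurNone, sub_eq_add_neg]
    refine (hA.2 (some u) (some w) (by simpa using h.ne)).parallel ?_ ?_
    · have h1 := (hA.2 none (some u) (by simp)).series (hA.2 none (some w) (by simp)) h.adj_u
        h.adj_w h.not_both
      rw [hA.1.apply none (some u)]
      have hneg : -(A none (some u) * A none (some w) / A none none)
        = -(A none (some u) * A none (some w)) / A none none := by ring
      rw [hneg]
      exact ⟨fun hh => div_neg_of_neg_of_pos (h1.1 hh) hd, fun hh => div_pos (h1.2.1 hh) hd,
        fun he ho => by rw [h1.2.2 he ho, zero_div]⟩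
    · have h1 := h.adj_u
      have h2 := h.adj_w
      rw [Adj] at h1 h2
      tauto
  refine ⟨hB, fun i j hij => ?_⟩
  by_cases hs : s(i, j) = s(u, w)
  · rcases Sym2.eq_iff.1 hs with ⟨rfl, rfl⟩ | ⟨rfl, rfl⟩
    · exact huw
    · rw [hB.apply]
      have e1 : Q.even i j ↔ Q.even j i := ⟨Q.even_symm _ _, Q.even_symm _ _⟩
      have e2 : Q.odd i j ↔ Q.odd j i := ⟨Q.odd_symm _ _, Q.odd_symm _ _⟩
      rwa [e1, e2]
  · rw [h.even_iff i j hs, h.odd_iff i j hs]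
    have h0 : A (some i) none * A none (some j) = 0 := by
      by_contra hne
      have hj : P.Adj none (some j) := by
        by_contra hc
        exact hne (by rw [(hA.2 none (some j) (by simp)).2.2 (fun x => hc (.inl x))
          (fun x => hc (.inr x)), mul_zero])
      have hi : P.Adj none (some i) := by
        by_contra hc
        exact hne (by rw [hA.1.apply none (some i), (hA.2 none (some i) (by simp)).2.2
          (fun x => hc (.inl x)) (fun x => hc (.inr x)), zero_mul])
      rcases (h.adj_none_iff i).1 hi with rfl | rfl <;>
        rcases (h.adj_none_iff j).1 hj with rfl | rfl
      · exact hij rfl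
      · exact hs rfl
      · exact hs Sym2.eq_swap
      · exact hij rfl
    rw [schurNone, h0, zero_div, sub_zero]
    exact hA.2 _ _ (by simpa using hij)

/-- With pivot 1 and column `b` supported on `u` and `w`, the remaining block must be `B + b bᵀ`.
Off the diagonal this alters only the entry at `u`, `w`, by `b u * b w`. That product is chosen by
splitting `B u w` into the shares of the old edges and of the path through `none`. -/
theorem exists_schurNone_eq (h : IsReduction P Q u w) {B : Matrix m m ℝ} (hB : B ∈ Q.matrices) :
    ∃ A ∈ P.matrices, A none none = 1 ∧ schurNone A = B := by
  classical
  have huw := hB.2 u w h.ne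
  have hadj : ((P.even none (some u) ∧ P.even none (some w)) ∨
      (P.odd none (some u) ∧ P.odd none (some w))) ∨ ((P.even none (some u) ∧ P.odd none (some w)) ∨
      (P.odd none (some u) ∧ P.even none (some w))) := by
    have h1 := h.adj_u
    have h2 := h.adj_w
    rw [Adj] at h1 h2
    tauto
  rw [h.even_uw, h.odd_uw] at huw
  obtain ⟨r, hr, hc⟩ := huw.exists_parallel hadj
  obtain ⟨p, q, hp, hq, rfl⟩ := hr.exists_series h.adj_w h.not_both
  set b : m → ℝ := Pi.single u p + Pi.single w q with hb
  have hbu : b u = p := by simp [hb, h.ne]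
  have hbw : b w = q := by simp [hb, h.ne.symm]
  have hb0 : ∀ k, k ≠ u → k ≠ w → b k = 0 := fun k h1 h2 => by simp [hb, h1, h2]
  set A : Matrix (Option m) (Option m) ℝ := fun i j =>
    i.elim (j.elim 1 b) fun i => j.elim (b i) fun j => B i j + b i * b j with hA
  have hbadm : ∀ k, SignAdmissible (P.even none (some k)) (P.odd none (some k)) (b k) := by
    intro k
    by_cases hku : k = u
    · rw [hku, hbu]; exact hp
    by_cases hkw : k = w
    · rw [hkw, hbw]; exact hq
    have hk : ¬ P.Adj none (some k) := fun hk => ((h.adj_none_iff k).1 hk).elim hku hkw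
    rw [hb0 k hku hkw]
    exact ⟨fun hh => absurd (.inl hh.1) hk, fun hh => absurd (.inr hh.1) hk, fun _ _ => rfl⟩
  have hsym : ∀ i j, (P.even i j ↔ P.even j i) ∧ (P.odd i j ↔ P.odd j i) := fun i j =>
    ⟨⟨P.even_symm _ _, P.even_symm _ _⟩, ⟨P.odd_symm _ _, P.odd_symm _ _⟩⟩
  have hAs : A.IsSymm := by
    ext i j
    rcases i with - | i <;> rcases j with - | j
    · rfl
    · rfl
    · rfl
    · change B j i + b j * b i = B i j + b i * b j
      rw [hB.1.apply, mul_comm]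
  refine ⟨A, ⟨hAs, fun i j hij => ?_⟩, rfl, ?_⟩
  · cases i with
    | none =>
      cases j with
      | none => exact absurd rfl hij
      | some j => exact hbadm j
    | some i =>
      cases j with
      | none =>
        rw [(hsym _ _).1, (hsym _ _).2]
        exact hbadm i
      | some j =>
        have hij' : i ≠ j := fun h' => hij (congrArg some h')
        by_cases hs : s(i, j) = s(u, w)
        · have hc' : SignAdmissible (P.even (some u) (some w)) (P.odd (some u) (some w))
              (A (some u) (some w)) := by
            simpa only [hA, Option.elim, hbu, hbw] using hc
          rcases Sym2.eq_iff.1 hs with ⟨rfl, rfl⟩ | ⟨rfl, rfl⟩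
          · exact hc'
          · rwa [(hsym _ _).1, (hsym _ _).2, hAs.apply]
        · rw [← h.even_iff i j hs, ← h.odd_iff i j hs]
          have h0 : b i * b j = 0 := by
            by_contra hne
            have key : ∀ k, b k ≠ 0 → k = u ∨ k = w := fun k hk => by
              by_contra hc
              exact hk (hb0 k (fun x => hc (.inl x)) (fun x => hc (.inr x)))
            rcases key i (left_ne_zero_of_mul hne) with rfl | rfl <;>
              rcases key j (right_ne_zero_of_mul hne) with rfl | rfl
            · exact hij' rfl
            · exact hs rfl
            · exact hs Sym2.eq_swap
            · exact hij' rfl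
          simp only [hA, Option.elim, h0, add_zero]
          exact hB.2 i j hij'
  · ext i j
    simp [schurNone, hA]

theorem nullities_eq [Fintype m] (h : IsReduction P Q u w) : Q.nullities = P.nullities := by
  ext k
  constructor
  · rintro ⟨B, hB, hpos, hsap, rfl⟩
    obtain ⟨A, hA, hd, rfl⟩ := h.exists_schurNone_eq hB
    have hd0 : 0 < A none none := hd ▸ one_pos
    exact ⟨A, hA, (posSemidef_schurNone_iff hA.1 hd0).1 hpos,
      (h.hasSAP_schurNone_iff hA hd0.ne').1 hsap, (nullity_schurNone hd0.ne').symm⟩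
  · rintro ⟨A, hA, hpos, hsap, rfl⟩
    have hw : A (some w) none ≠ 0 := by
      rw [hA.1.apply]
      exact (hA.2 none (some w) (by simp)).ne_zero h.adj_w h.not_both
    have hd0 := pos_none_of_posSemidef hpos hw
    exact ⟨schurNone A, h.schurNone_mem hA hd0, (posSemidef_schurNone_iff hA.1 hd0).2 hpos,
      (h.hasSAP_schurNone_iff hA hd0.ne').2 hsap, nullity_schurNone hd0.ne'⟩

end IsReduction

end SignPattern

end

/-! ### From signed graphs to sign patterns -/

namespace SignedGraph

variable {α β : Type*}

theorem ne_of_isLink (G : SignedGraph α β) {e : β} {x y : α} (h : G.graph.IsLink e x y) : x ≠ y := by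
  rintro rfl
  exact G.loopless.not_isLoopAt e x h

/-- The signs of the edges between each pair of vertices. -/
def pattern (G : SignedGraph α β) : SignPattern V(G.graph) where
  even i j := ∃ e, G.graph.IsLink e i j ∧ e ∉ G.odd
  odd i j := ∃ e, G.graph.IsLink e i j ∧ e ∈ G.odd
  even_symm _ _ := fun ⟨e, h, he⟩ => ⟨e, h.symm, he⟩
  odd_symm _ _ := fun ⟨e, h, he⟩ => ⟨e, h.symm, he⟩
  even_irrefl _ := fun ⟨_, h, _⟩ => G.ne_of_isLink h rfl
  odd_irrefl _ := fun ⟨_, h, _⟩ => G.ne_of_isLink h rfl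

theorem pattern_adj_iff (G : SignedGraph α β) (i j : V(G.graph)) :
    G.pattern.Adj i j ↔ G.graph.Adj i j := by
  constructor
  · rintro (⟨e, h, -⟩ | ⟨e, h, -⟩) <;> exact ⟨e, h⟩
  · rintro ⟨e, h⟩
    by_cases he : e ∈ G.odd
    · exact .inr ⟨e, h, he⟩
    · exact .inl ⟨e, h, he⟩

theorem onlyEven_iff (G : SignedGraph α β) (i j : V(G.graph)) :
    G.OnlyEven i j ↔ G.pattern.even i j ∧ ¬ G.pattern.odd i j := by
  constructor
  · rintro ⟨⟨e, he⟩, h⟩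
    exact ⟨⟨e, he, h e he⟩, fun ⟨d, hd, hd'⟩ => h d hd hd'⟩
  · rintro ⟨⟨e, he, -⟩, h⟩
    exact ⟨⟨e, he⟩, fun d hd hd' => h ⟨d, hd, hd'⟩⟩

theorem onlyOdd_iff (G : SignedGraph α β) (i j : V(G.graph)) :
    G.OnlyOdd i j ↔ G.pattern.odd i j ∧ ¬ G.pattern.even i j := by
  constructor
  · rintro ⟨⟨e, he⟩, h⟩
    exact ⟨⟨e, he, h e he⟩, fun ⟨d, hd, hd'⟩ => hd' (h d hd)⟩
  · rintro ⟨⟨e, he, -⟩, h⟩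
    exact ⟨⟨e, he⟩, fun d hd => by_contra fun hd' => h ⟨d, hd, hd'⟩⟩

theorem matrices_eq (G : SignedGraph α β) : G.matrices = G.pattern.matrices := by
  ext A
  constructor
  · rintro ⟨hs, h1, h2, h3⟩
    refine ⟨hs, fun i j hij => ⟨fun h => h1 i j ((G.onlyEven_iff i j).2 h),
      fun h => h2 i j ((G.onlyOdd_iff i j).2 h), fun he ho => h3 i j hij fun h => ?_⟩⟩
    exact ((G.pattern_adj_iff i j).2 h).elim he ho
  · rintro ⟨hs, h⟩
    refine ⟨hs, fun i j hij => ?_, fun i j hij => ?_, fun i j hne hij => ?_⟩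
    · rw [onlyEven_iff] at hij
      exact (h i j (SignPattern.Adj.ne (.inl hij.1))).1 hij
    · rw [onlyOdd_iff] at hij
      exact (h i j (SignPattern.Adj.ne (.inr hij.1))).2.1 hij
    · rw [← pattern_adj_iff] at hij
      exact (h i j hne).2.2 (fun he => hij (.inl he)) (fun ho => hij (.inr ho))

theorem nu_eq_sSup_nullities (G : SignedGraph α β) : G.nu = sSup G.pattern.nullities := by
  have hsap : ∀ A, G.HasSAP A ↔ G.pattern.HasSAP A := fun A => by
    simp only [HasSAP, SignPattern.HasSAP, pattern_adj_iff]
  simp only [nu, SignPattern.nullities, matrices_eq, hsap]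

theorem mem_cut_iff (G : SignedGraph α β) (U : Set α) {e : β} {x y : α}
    (h : G.graph.IsLink e x y) : e ∈ G.cut U ↔ ¬ (x ∈ U ↔ y ∈ U) := by
  constructor
  · rintro ⟨a, b, hab, ha, hb⟩
    rcases h.eq_and_eq_or_eq_and_eq hab with ⟨rfl, rfl⟩ | ⟨rfl, rfl⟩
    · exact fun hh => hb (hh.1 ha)
    · exact fun hh => hb (hh.2 ha)
  · intro hh
    by_cases hx : x ∈ U
    · exact ⟨x, y, h, hx, fun hy => hh (iff_of_true hx hy)⟩
    · exact ⟨y, x, h.symm, by_contra fun hy => hh (iff_of_false hx hy), hx⟩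

theorem isSwitching_resign (G : SignedGraph α β) (U : Set α) :
    SignPattern.IsSwitching G.pattern (G.resign U).pattern fun i => (i : α) ∈ U := by
  have hodd : ∀ e, e ∈ (G.resign U).odd ↔ (e ∈ G.odd ∧ e ∉ G.cut U) ∨ (e ∈ G.cut U ∧ e ∉ G.odd) :=
    fun e => Set.mem_symmDiff
  refine ⟨fun i j hij => ⟨exists_congr fun e => and_congr_right fun h => ?_,
    exists_congr fun e => and_congr_right fun h => ?_⟩,
    fun i j hij => ⟨exists_congr fun e => and_congr_right fun h => ?_,
    exists_congr fun e => and_congr_right fun h => ?_⟩⟩ <;>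
  · have hc := G.mem_cut_iff U h
    rw [hodd]
    tauto

theorem nu_resign (G : SignedGraph α β) (U : Set α) : (G.resign U).nu = G.nu := by
  rw [nu_eq_sSup_nullities, nu_eq_sSup_nullities, (G.isSwitching_resign U).nullities_eq]
  rfl

/-- Reduces both graph operations to a statement about patterns: `none` stands for `v`, and `φ`
identifies the vertices of `H` with the other vertices of `G`. -/
theorem nu_eq_of_isReduction (G H : SignedGraph α β) (v : V(G.graph))
    (φ : V(H.graph) → V(G.graph)) (hinj : φ.Injective) (hv : ∀ t, φ t ≠ v)
    (hsurj : ∀ x, x ≠ v → ∃ t, φ t = x) {u w : V(H.graph)}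
    (h : SignPattern.IsReduction (G.pattern.comap fun o : Option V(H.graph) => o.elim v φ)
      H.pattern u w) : H.nu = G.nu := by
  have hbij : Function.Bijective fun o : Option V(H.graph) => o.elim v φ := by
    constructor
    · rintro (- | a) (- | b) hab
      · rfl
      · exact absurd hab.symm (hv b)
      · exact absurd hab (hv a)
      · exact congrArg some (hinj hab)
    · intro x
      by_cases hx : x = v
      · exact ⟨none, hx.symm⟩
      · obtain ⟨t, ht⟩ := hsurj x hx
        exact ⟨some t, ht⟩
  rw [nu_eq_sSup_nullities, nu_eq_sSup_nullities, h.nullities_eq,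
    ← G.pattern.nullities_comap (Equiv.ofBijective _ hbij)]
  rfl

/-! ### The two graph operations -/

theorem nu_eq_of_isSeriesReduction (G H : SignedGraph α β) (v : α)
    (h : G.IsSeriesReduction v H) : H.nu = G.nu := by
  obtain ⟨e, f, b, u, w, he, hf, huw, hinc, hb, hV, hlink, hodd, hbodd⟩ := h
  have hvu := G.ne_of_isLink he
  have hvw := G.ne_of_isLink hf
  have hv : ∀ d x, G.graph.IsLink d v x ↔ (d = e ∧ x = u) ∨ (d = f ∧ x = w) := by
    intro d x
    constructor
    · intro hd
      have : d ∈ G.graph.incidenceSet v := ⟨x, hd⟩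
      rw [hinc] at this
      rcases this with rfl | rfl
      · exact .inl ⟨rfl, hd.right_unique he⟩
      · exact .inr ⟨rfl, hd.right_unique hf⟩
    · rintro (⟨rfl, rfl⟩ | ⟨rfl, rfl⟩)
      · exact he
      · exact hf
  have hmem : ∀ t, t ∈ V(H.graph) ↔ t ∈ V(G.graph) ∧ t ≠ v := fun t => by
    rw [hV]; rfl
  have hdel : ∀ d x y, (G.graph.deleteVerts {v}).IsLink d x y ↔
      G.graph.IsLink d x y ∧ x ≠ v ∧ y ≠ v := fun d x y => by simp
  refine nu_eq_of_isReduction G H ⟨v, he.left_mem⟩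
    (fun t => ⟨t, ((hmem t).1 t.2).1⟩) (fun a b hab => Subtype.ext (Subtype.mk.inj hab))
    (fun t ht => ((hmem t).1 t.2).2 (congrArg Subtype.val ht))
    (fun x hx => ⟨⟨x, (hmem x).2 ⟨x.2, fun h' => hx (Subtype.ext h')⟩⟩, rfl⟩)
    (u := ⟨u, (hmem u).2 ⟨he.right_mem, hvu.symm⟩⟩) (w := ⟨w, (hmem w).2 ⟨hf.right_mem, hvw.symm⟩⟩)
    ?_
  have hHlink : ∀ (d : β) (i j : V(H.graph)), H.graph.IsLink d i j ↔
      G.graph.IsLink d i j ∨ (d = b ∧ s((i : α), (j : α)) = s(u, w)) := fun d i j => by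
    rw [hlink, hdel, and_iff_left ⟨((hmem i).1 i.2).2, ((hmem j).1 j.2).2⟩]
  have hoddG : ∀ (d : β) (i j : V(H.graph)), G.graph.IsLink d i j → (d ∈ H.odd ↔ d ∈ G.odd) :=
    fun d i j hd => hodd d
      ((hdel d i j).2 ⟨hd, ((hmem i).1 i.2).2, ((hmem j).1 j.2).2⟩).edge_mem
  have hvu_iff : ∀ p : β → Prop, (∃ d, G.graph.IsLink d v u ∧ p d) ↔ p e := fun p => by
    simp [hv, huw]
  have hvw_iff : ∀ p : β → Prop, (∃ d, G.graph.IsLink d v w ∧ p d) ↔ p f := fun p => by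
    simp [hv, huw.symm]
  constructor
  · exact fun h' => huw (congrArg Subtype.val h')
  · intro i
    change (∃ d, G.graph.IsLink d v i ∧ d ∉ G.odd) ∨ (∃ d, G.graph.IsLink d v i ∧ d ∈ G.odd) ↔ _
    rw [Subtype.ext_iff, Subtype.ext_iff]
    constructor
    · rintro (⟨d, hd, -⟩ | ⟨d, hd, -⟩) <;>
        exact ((hv _ _).1 hd).imp And.right And.right
    · intro hi
      obtain ⟨d, hd⟩ : ∃ d, G.graph.IsLink d v i := by
        rcases hi with hi | hi
        · exact ⟨e, hi ▸ he⟩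
        · exact ⟨f, hi ▸ hf⟩
      by_cases hd' : d ∈ G.odd
      · exact .inr ⟨d, hd, hd'⟩
      · exact .inl ⟨d, hd, hd'⟩
  -- The single edge `f` joins `v` to `w`, so it would have to be both even and odd.
  · rintro ⟨h1, h2⟩
    exact (hvw_iff (· ∉ G.odd)).1 h1 ((hvw_iff (· ∈ G.odd)).1 h2)
  · intro i j hij
    have hs : s((i : α), (j : α)) ≠ s(u, w) := fun h' => hij <|
      (Sym2.map.injective Subtype.val_injective) h'
    refine exists_congr fun d => ?_
    rw [hHlink, or_iff_left fun h' => hs h'.2]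
    exact and_congr_right fun h' => not_congr (hoddG d i j h')
  · intro i j hij
    have hs : s((i : α), (j : α)) ≠ s(u, w) := fun h' => hij <|
      (Sym2.map.injective Subtype.val_injective) h'
    refine exists_congr fun d => ?_
    rw [hHlink, or_iff_left fun h' => hs h'.2]
    exact and_congr_right fun h' => hoddG d i j h'
  · change (∃ d, H.graph.IsLink d u w ∧ d ∉ H.odd) ↔ (∃ d, G.graph.IsLink d u w ∧ d ∉ G.odd) ∨
      (((∃ d, G.graph.IsLink d v u ∧ d ∉ G.odd) ∧ (∃ d, G.graph.IsLink d v w ∧ d ∉ G.odd)) ∨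
      ((∃ d, G.graph.IsLink d v u ∧ d ∈ G.odd) ∧ (∃ d, G.graph.IsLink d v w ∧ d ∈ G.odd)))
    rw [hvu_iff (· ∉ G.odd), hvw_iff (· ∉ G.odd), hvu_iff (· ∈ G.odd), hvw_iff (· ∈ G.odd)]
    have hbo : (e ∉ G.odd ∧ f ∉ G.odd ∨ e ∈ G.odd ∧ f ∈ G.odd) ↔ b ∉ H.odd := by
      rw [hbodd, xor_def]; tauto
    rw [hbo]
    have := fun d => hHlink d ⟨u, (hmem u).2 ⟨he.right_mem, hvu.symm⟩⟩
      ⟨w, (hmem w).2 ⟨hf.right_mem, hvw.symm⟩⟩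
    have hoddG' := fun d => hoddG d ⟨u, (hmem u).2 ⟨he.right_mem, hvu.symm⟩⟩
      ⟨w, (hmem w).2 ⟨hf.right_mem, hvw.symm⟩⟩
    constructor
    · rintro ⟨d, hd, hd'⟩
      rcases (this d).1 hd with h' | ⟨rfl, -⟩
      · exact .inl ⟨d, h', fun h'' => hd' ((hoddG' d h').2 h'')⟩
      · exact .inr hd'
    · rintro (⟨d, hd, hd'⟩ | hd')
      · exact ⟨d, (this d).2 (.inl hd), fun h'' => hd' ((hoddG' d hd).1 h'')⟩
      · exact ⟨b, (this b).2 (.inr ⟨rfl, rfl⟩), hd'⟩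
  · change (∃ d, H.graph.IsLink d u w ∧ d ∈ H.odd) ↔ (∃ d, G.graph.IsLink d u w ∧ d ∈ G.odd) ∨
      (((∃ d, G.graph.IsLink d v u ∧ d ∉ G.odd) ∧ (∃ d, G.graph.IsLink d v w ∧ d ∈ G.odd)) ∨
      ((∃ d, G.graph.IsLink d v u ∧ d ∈ G.odd) ∧ (∃ d, G.graph.IsLink d v w ∧ d ∉ G.odd)))
    rw [hvu_iff (· ∉ G.odd), hvw_iff (· ∉ G.odd), hvu_iff (· ∈ G.odd), hvw_iff (· ∈ G.odd)]
    have hbo : (e ∉ G.odd ∧ f ∈ G.odd ∨ e ∈ G.odd ∧ f ∉ G.odd) ↔ b ∈ H.odd := by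
      rw [hbodd, xor_def]; tauto
    rw [hbo]
    have := fun d => hHlink d ⟨u, (hmem u).2 ⟨he.right_mem, hvu.symm⟩⟩
      ⟨w, (hmem w).2 ⟨hf.right_mem, hvw.symm⟩⟩
    have hoddG' := fun d => hoddG d ⟨u, (hmem u).2 ⟨he.right_mem, hvu.symm⟩⟩
      ⟨w, (hmem w).2 ⟨hf.right_mem, hvw.symm⟩⟩
    constructor
    · rintro ⟨d, hd, hd'⟩
      rcases (this d).1 hd with h' | ⟨rfl, -⟩
      · exact .inl ⟨d, h', (hoddG' d h').1 hd'⟩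
      · exact .inr hd'
    · rintro (⟨d, hd, hd'⟩ | hd')
      · exact ⟨d, (this d).2 (.inl hd), (hoddG' d hd).2 hd'⟩
      · exact ⟨b, (this b).2 (.inr ⟨rfl, rfl⟩), hd'⟩

-- Contracting the even edge `g` turns `e` and `f` into `u`-`w` edges with their signs kept. These
-- are exactly the product signs of the paths `u`-`v`-`w`, so the contraction is a suppression of
-- `v`.
open Classical in
theorem nu_eq_of_isEvenContraction (G H : SignedGraph α β) {v u w : α} {e f g : β}
    (he : G.graph.IsLink e v u) (hf : G.graph.IsLink f v u) (hg : G.graph.IsLink g v w)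
    (huw : u ≠ w) (hinc : G.graph.incidenceSet v = {e, f, g}) (h : G.IsEvenContraction g H) :
    H.nu = G.nu := by
  obtain ⟨x, y, z, hxy, hgodd, hz, hgraph, hodd⟩ := h
  have hvu := G.ne_of_isLink he
  have hvw := G.ne_of_isLink hg
  have hpair : ({x, y} : Set α) = {v, w} := by
    rcases hxy.eq_and_eq_or_eq_and_eq hg with ⟨rfl, rfl⟩ | ⟨rfl, rfl⟩
    · rfl
    · exact Set.pair_comm _ _
  rw [hpair] at hz
  set κ : α → α := fun t => if t = v ∨ t = w then z else t with hκ
  have hgraph : H.graph = (G.graph.deleteEdges {g}).map κ := by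
    rw [hgraph]
    congr 1
    funext t
    have : (t = x ∨ t = y) ↔ (t = v ∨ t = w) := by
      simpa using Set.ext_iff.1 hpair t
    simp only [hκ, this]
  have hκv : κ v = z := if_pos (.inl rfl)
  have hκw : κ w = z := if_pos (.inr rfl)
  have hκne : ∀ t, t ≠ v → t ≠ w → κ t = t := fun t h1 h2 => if_neg (not_or.2 ⟨h1, h2⟩)
  have hzne : ∀ t ∈ V(G.graph), t ≠ v → t ≠ w → t ≠ z := fun t ht h1 h2 h3 => by
    subst h3
    exact hz ⟨ht, fun h' => h'.elim h1 h2⟩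
  have hVH : V(H.graph) = κ '' V(G.graph) := by rw [hgraph]; rfl
  have hlinkH : ∀ d i j, H.graph.IsLink d i j ↔
      ∃ a b, (G.graph.IsLink d a b ∧ d ≠ g) ∧ κ a = i ∧ κ b = j := fun d i j => by
    rw [hgraph]; rfl
  -- A section of the contraction map `κ`: the merged vertex `z` is read as `w`, so that `v` is the
  -- vertex that disappears.
  set ψ : α → α := fun t => if t = z then w else t with hψ
  have hψz : ψ z = w := if_pos rfl
  have hψκ : ∀ t ∈ V(G.graph), t ≠ v → ψ (κ t) = t := fun t ht htv => by
    by_cases htw : t = w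
    · rw [htw, hκw, hψz]
    · rw [hκne t htv htw]
      exact if_neg (hzne t ht htv htw)
  have hκψ : ∀ t ∈ V(H.graph), ψ t ∈ V(G.graph) ∧ ψ t ≠ v ∧ κ (ψ t) = t := by
    intro t ht
    rw [hVH] at ht
    obtain ⟨a, ha, rfl⟩ := ht
    by_cases hav : a = v
    · rw [hav, hκv, hψz]
      exact ⟨hg.right_mem, hvw.symm, hκw⟩
    · rw [hψκ a ha hav]
      exact ⟨ha, hav, rfl⟩
  have hκmem : ∀ t ∈ V(G.graph), κ t ∈ V(H.graph) := fun t ht => by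
    rw [hVH]; exact ⟨t, ht, rfl⟩
  have hge : g ≠ e := by
    rintro rfl
    exact huw (he.right_unique hg)
  have hgf : g ≠ f := by
    rintro rfl
    exact huw (hf.right_unique hg)
  have hv : ∀ d x, G.graph.IsLink d v x ↔ ((d = e ∨ d = f) ∧ x = u) ∨ (d = g ∧ x = w) := by
    intro d x
    constructor
    · intro hd
      have : d ∈ G.graph.incidenceSet v := ⟨x, hd⟩
      rw [hinc] at this
      rcases this with rfl | rfl | rfl
      · exact .inl ⟨.inl rfl, hd.right_unique he⟩
      · exact .inl ⟨.inr rfl, hd.right_unique hf⟩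
      · exact .inr ⟨rfl, hd.right_unique hg⟩
    · rintro (⟨rfl | rfl, rfl⟩ | ⟨rfl, rfl⟩)
      · exact he
      · exact hf
      · exact hg
  -- Read through `ψ`, the edges of `H` are those of `G` avoiding `v`, together with `e` and `f`
  -- moved to the pair `u`, `w`.
  have hHlink : ∀ (d : β) (i j : V(H.graph)), H.graph.IsLink d i j ↔
      G.graph.IsLink d (ψ i) (ψ j) ∨ ((d = e ∨ d = f) ∧ s(ψ i, ψ j) = s(u, w)) := by
    intro d i j
    obtain ⟨hi1, hi2, hi3⟩ := hκψ i i.2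
    obtain ⟨hj1, hj2, hj3⟩ := hκψ j j.2
    rw [hlinkH]
    constructor
    · rintro ⟨a, b, ⟨hab, hdg⟩, hai, hbj⟩
      by_cases hav : a = v
      · subst hav
        rcases (hv d b).1 hab with ⟨hd, rfl⟩ | ⟨hd, -⟩
        · refine .inr ⟨hd, ?_⟩
          rw [← hai, ← hbj, hκv, hψz, hψκ b he.right_mem hvu.symm, Sym2.eq_swap]
        · exact absurd hd hdg
      by_cases hbv : b = v
      · subst hbv
        rcases (hv d a).1 hab.symm with ⟨hd, rfl⟩ | ⟨hd, -⟩
        · refine .inr ⟨hd, ?_⟩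
          rw [← hai, ← hbj, hκv, hψz, hψκ a he.right_mem hvu.symm]
        · exact absurd hd hdg
      rw [← hai, ← hbj, hψκ a hab.left_mem hav, hψκ b hab.right_mem hbv]
      exact .inl hab
    · rintro (hd | ⟨hd, hs⟩)
      · refine ⟨ψ i, ψ j, ⟨hd, ?_⟩, hi3, hj3⟩
        rintro rfl
        rcases hg.eq_and_eq_or_eq_and_eq hd with ⟨h1, -⟩ | ⟨h1, -⟩
        · exact hi2 h1.symm
        · exact hj2 h1.symm
      · have hdg : d ≠ g := by
          rintro rfl
          exact hd.elim hge hgf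
        have hdu : G.graph.IsLink d v u := (hv d u).2 (.inl ⟨hd, rfl⟩)
        rcases Sym2.eq_iff.1 hs with ⟨h1, h2⟩ | ⟨h1, h2⟩
        · refine ⟨u, v, ⟨hdu.symm, hdg⟩, ?_, ?_⟩
          · rw [← h1, hi3]
          · rw [hκv, ← hκw, ← h2, hj3]
        · refine ⟨v, u, ⟨hdu, hdg⟩, ?_, ?_⟩
          · rw [hκv, ← hκw, ← h1, hi3]
          · rw [← h2, hj3]
  have hψinj : ∀ i j : V(H.graph), ψ i = ψ j → i = j := fun i j hij => by
    apply Subtype.ext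
    rw [← (hκψ i i.2).2.2, hij, (hκψ j j.2).2.2]
  have hψu : ψ (κ u) = u := hψκ u he.right_mem hvu.symm
  have hψw : ψ (κ w) = w := hψκ w hg.right_mem hvw.symm
  have hψeq : ∀ (i : V(H.graph)), ∀ t (ht : t ∈ V(G.graph)), t ≠ v →
      (i = ⟨κ t, hκmem t ht⟩ ↔ ψ i = t) := fun i t ht htv => by
    constructor
    · rintro rfl
      exact hψκ t ht htv
    · exact fun h' => hψinj _ _ (h'.trans (hψκ t ht htv).symm)
  refine nu_eq_of_isReduction G H ⟨v, he.left_mem⟩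
    (fun t => ⟨ψ t, (hκψ t t.2).1⟩) (fun a b hab => hψinj a b (Subtype.mk.inj hab))
    (fun t ht => (hκψ t t.2).2.1 (congrArg Subtype.val ht))
    (fun x hx => ⟨⟨κ x, hκmem x x.2⟩,
      Subtype.ext (hψκ x x.2 fun h' => hx (Subtype.ext h'))⟩)
    (u := ⟨κ u, hκmem u he.right_mem⟩) (w := ⟨κ w, hκmem w hg.right_mem⟩) ?_
  have hvw_iff : ∀ d, G.graph.IsLink d v w ↔ d = g := fun d => by
    simp [hv, huw.symm]
  have hvu_iff : ∀ d, G.graph.IsLink d v u ↔ d = e ∨ d = f := fun d => by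
    simp [hv, huw]
  have hsym : ∀ i j : V(H.graph), s(i, j) ≠ s((⟨κ u, hκmem u he.right_mem⟩ : V(H.graph)),
      ⟨κ w, hκmem w hg.right_mem⟩) → s(ψ i, ψ j) ≠ s(u, w) := fun i j hij hs => hij <| by
    rw [Sym2.eq_iff] at hs ⊢
    simpa only [hψeq _ u he.right_mem hvu.symm, hψeq _ w hg.right_mem hvw.symm] using hs
  have hHuw : ∀ d, H.graph.IsLink d (κ u) (κ w) ↔ G.graph.IsLink d u w ∨ (d = e ∨ d = f) :=
    fun d => by
      have := hHlink d ⟨κ u, hκmem u he.right_mem⟩ ⟨κ w, hκmem w hg.right_mem⟩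
      rwa [hψu, hψw, and_iff_left rfl] at this
  constructor
  · intro h'
    have := congrArg (fun t : V(H.graph) => ψ t) h'
    exact huw (by rwa [← hψu, ← hψw])
  · intro i
    rw [hψeq i u he.right_mem hvu.symm, hψeq i w hg.right_mem hvw.symm]
    refine Iff.trans (G.pattern_adj_iff ⟨v, he.left_mem⟩ ⟨ψ i, (hκψ i i.2).1⟩) ?_
    constructor
    · rintro ⟨d, hd⟩
      exact ((hv _ _).1 hd).imp And.right And.right
    · rintro (hi | hi)
      · exact ⟨e, (hv _ _).2 (.inl ⟨.inl rfl, hi⟩)⟩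
      · exact ⟨g, (hv _ _).2 (.inr ⟨rfl, hi⟩)⟩
  · rintro ⟨-, d, hd, hd'⟩
    change G.graph.IsLink d v (ψ (κ w)) at hd
    rw [hψw, hvw_iff] at hd
    exact hgodd (hd ▸ hd')
  · intro i j hij
    refine exists_congr fun d => ?_
    rw [hHlink, or_iff_left fun h' => hsym i j hij h'.2, hodd]
    exact Iff.rfl
  · intro i j hij
    refine exists_congr fun d => ?_
    rw [hHlink, or_iff_left fun h' => hsym i j hij h'.2, hodd]
    exact Iff.rfl
  · change (∃ d, H.graph.IsLink d (κ u) (κ w) ∧ d ∉ H.odd) ↔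
      (∃ d, G.graph.IsLink d (ψ (κ u)) (ψ (κ w)) ∧ d ∉ G.odd) ∨
      (((∃ d, G.graph.IsLink d v (ψ (κ u)) ∧ d ∉ G.odd) ∧
        (∃ d, G.graph.IsLink d v (ψ (κ w)) ∧ d ∉ G.odd)) ∨
      ((∃ d, G.graph.IsLink d v (ψ (κ u)) ∧ d ∈ G.odd) ∧
        (∃ d, G.graph.IsLink d v (ψ (κ w)) ∧ d ∈ G.odd)))
    simp only [hψu, hψw, hvw_iff, hvu_iff, hHuw, hodd, exists_eq_left, hgodd, not_false_eq_true,
      and_true, and_false, or_false, or_and_right, exists_or]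
  · change (∃ d, H.graph.IsLink d (κ u) (κ w) ∧ d ∈ H.odd) ↔
      (∃ d, G.graph.IsLink d (ψ (κ u)) (ψ (κ w)) ∧ d ∈ G.odd) ∨
      (((∃ d, G.graph.IsLink d v (ψ (κ u)) ∧ d ∉ G.odd) ∧
        (∃ d, G.graph.IsLink d v (ψ (κ w)) ∧ d ∈ G.odd)) ∨
      ((∃ d, G.graph.IsLink d v (ψ (κ u)) ∧ d ∈ G.odd) ∧
        (∃ d, G.graph.IsLink d v (ψ (κ w)) ∧ d ∉ G.odd)))
    simp only [hψu, hψw, hvw_iff, hvu_iff, hHuw, hodd, exists_eq_left, hgodd, not_false_eq_true,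
      and_true, and_false, false_or, or_and_right, exists_or]

/-- When `g` is odd, re-signing leaves ν and the underlying graph unchanged, so the even case
applies to the re-signed graph. -/
theorem nu_eq_of_isSeriesParallelReduction (G H : SignedGraph α β) (v : α)
    (h : G.IsSeriesParallelReduction v H) : H.nu = G.nu := by
  obtain ⟨e, f, g, u, w, -, he, hf, hg, huw, hinc, ⟨-, hc⟩ | ⟨-, x, -, hc⟩⟩ := h
  · exact nu_eq_of_isEvenContraction G H he hf hg huw hinc hc
  · rw [← G.nu_resign {x}]
    exact nu_eq_of_isEvenContraction (G.resign {x}) H he hf hg huw hinc hc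

end SignedGraph

theorem mainTheorem10 {α β : Type*} (G H : SignedGraph α β) (v : α)
    (h : G.IsSeriesReduction v H ∨ G.IsSeriesParallelReduction v H) :
    H.nu = G.nu :=
  h.elim (G.nu_eq_of_isSeriesReduction H v) (G.nu_eq_of_isSeriesParallelReduction H v)
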